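/- Let $\Gamma$ be a finite simplicial graph (no loops, no multiple edges) and let $\{G_v \mid v\in V(\Gamma)\}$ be a family of non-trivial groups. The graph product $G_\Gamma$ is the quotient of the free product of the groups $G_v$, $v\in V(\Gamma)$, by the normal closure of all commutators $[g,h]$ with $g\in G_v$, $h\in G_w$ and $\{v,w\}\in E(\Gamma)$ (the graph product over the empty graph is the trivial group). The star of a vertex $v$ is $st(v)=\{v\}\cup\{w\in V(\Gamma)\mid \{v,w\}\in E(\Gamma)\}$. A group $G$ is called semicomplete if the kernel of the natural homomorphism $\mathrm{Aut}(G)\to\mathrm{Aut}(G^{ab})$ induced by the abelianization $G\to G^{ab}$ is equal to the group $\mathrm{Inn}(G)$ of inner automorphisms. Let $\Delta$ be the subgraph of $\Gamma$ spanned by all vertices $v\in V(\Gamma)$ with $st(v)=V(\Gamma)$, and suppose that the vertex groups $G_v$, $v\in V(\Delta)$, are abelian. Then $G_\Gamma$ is semicomplete if and only if the graph product $G_{\langle V(\Gamma)-V(\Delta)\rangle}$ of the groups $G_v$, $v \in V(\Gamma)-V(\Delta)$, is semicomplete, where $\langle V(\Gamma)-V(\Delta)\rangle$ is the subgraph of $\Gamma$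 spanned by the vertex set $V(\Gamma)-V(\Delta)$. -/

import Mathlib

section GraphProducts

universe u v

/-- The star of a vertex `a`: the vertex itself together with all vertices adjacent to it. -/
def SimpleGraph.starSet {V : Type u} (Γ : SimpleGraph V) (a : V) : Set V :=
  {a} ∪ {w | Γ.Adj a w}

/-- The set of the vertices whose star is the whole vertex set. -/
def SimpleGraph.coneVertices {V : Type u} (Γ : SimpleGraph V) : Set V :=
  {a | Γ.starSet a = Set.univ}

/-- The defining relators of a graph product, inside the free product of the vertex groups:
the commutators of elements of vertex groups at adjacent vertices. -/
def graphProductRelators {V : Type u} (Γ : SimpleGraph V) (G : V → Type v)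
    [∀ a, Group (G a)] : Set (Monoid.CoprodI G) :=
  {r | ∃ a b : V, Γ.Adj a b ∧ ∃ (g : G a) (h : G b),
    r = Monoid.CoprodI.of g * Monoid.CoprodI.of h *
      (Monoid.CoprodI.of g)⁻¹ * (Monoid.CoprodI.of h)⁻¹}

/-- The graph product of the groups `G a` over `Γ`: the quotient of their free product by the
normal closure of the defining relators. -/
abbrev GraphProduct {V : Type u} (Γ : SimpleGraph V) (G : V → Type v)
    [∀ a, Group (G a)] : Type (max u v) :=
  Monoid.CoprodI G ⧸ Subgroup.normalClosure (graphProductRelators Γ G)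

/-- The natural homomorphism `Aut(G) → Aut(G^ab)`. -/
def autAbelianization (G : Type u) [Group G] : MulAut G →* MulAut (Abelianization G) where
  toFun f := MulEquiv.abelianizationCongr f
  map_one' := abelianizationCongr_refl
  map_mul' f g := (abelianizationCongr_trans g f).symm

/-- The group `IA(G)`: the automorphisms that induce the identity on the abelianization. -/
def iaAut (G : Type u) [Group G] : Subgroup (MulAut G) :=
  (autAbelianization G).ker

/-- The group `Inn(G)` of the inner automorphisms. -/
def innAut (G : Type u) [Group G] : Subgroup (MulAut G) :=
  (MulAut.conj : G →* MulAut G).range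

/-- A group is semicomplete if `IA(G) = Inn(G)`. -/
def IsSemicomplete (G : Type u) [Group G] : Prop :=
  iaAut G = innAut G

end GraphProducts

/-!
Let `Z` be the graph product over the cone vertices and `H` the one over the remaining vertices.
Since the vertex groups at cone vertices are abelian, they are central, so `G_Γ` retracts onto `H`
with central kernel `Z`: it is the direct product of `Z` and `H`. The argument has two halves.

The first half is that `H` has trivial center (`GraphProduct.center_eq_bot`). Its graph has no cone
vertices, so every vertex `c` has a non-neighbour `a ≠ c`. The kernel of the retraction of the
graph product that kills the vertex group at `c` is a free product of copies of that vertex group,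
indexed by the cosets, in the image of the retraction, of the subgroup `M` generated by the vertex
groups at the neighbours of `c`. It is convenient to index by all cosets of `M` in the graph
product; the graph product then embeds into the semidirect product of the resulting free product
with the graph product itself (`GraphProduct.ofSemidirect_toSemidirect`).
The free component of a central element commutes with
two distinct free factors, namely those of `M` and of `tM` for `t ≠ 1` in the vertex group at `a`,
and by the normal form in free products only `1` does so
(`Monoid.CoprodI.eq_one_of_commute_of_commute`). Hence a central element is fixed by the retraction
that kills the vertex group at `c` (`GraphProduct.kill_singleton_of_mem_center`). It is then fixed
by the composite of these retractions over all `c`, which is the trivial homomorphism.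

The second half (`isSemicomplete_iff_of_retract`) is group theory. As `H` is centerless, `Z` is the
whole center of `Z × H`. An automorphism of `Z × H` preserves `Z`, so it induces an automorphism
of `H`; if it is trivial on the abelianization `Z × H^ab`, it is determined by the induced one.
Conversely an automorphism of `H` extends by the identity on `Z`. Inner automorphisms correspond to
inner automorphisms.
-/

/-! ### Elements of a free product commuting with two free factors -/

namespace Monoid.CoprodI

section Word

variable {ι : Type*} {M : ι → Type*} [∀ i, Monoid (M i)] [DecidableEq ι]
  [∀ i, DecidableEq (M i)]

namespace Word

theorem length_equivPair_tail_le (i : ι) (w : Word M) :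
    (equivPair i w).tail.toList.length ≤ w.toList.length := by
  conv_rhs => rw [← (equivPair i).symm_apply_apply w, equivPair_symm, rcons]
  split_ifs
  · rfl
  · simp

theorem length_of_smul_le {i : ι} (m : M i) (w : Word M) :
    (of m • w).toList.length ≤ w.toList.length + 1 := by
  have h := length_equivPair_tail_le i w
  rw [of_smul_def, rcons]
  split_ifs
  · exact h.trans (Nat.le_succ _)
  · simpa using h

theorem length_of_smul_le_or_fstIdx_eq {i : ι} (m : M i) (w : Word M) :
    (of m • w).toList.length ≤ w.toList.length ∨ (of m • w).fstIdx = some i := by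
  rw [of_smul_def, rcons]
  split_ifs
  · exact Or.inl (length_equivPair_tail_le i w)
  · exact Or.inr (fstIdx_cons _ _ _ _)

theorem length_prod_smul_le (l : List (Σ i, M i)) (w : Word M) :
    ((l.map fun s => of s.2).prod • w).toList.length ≤ l.length + w.toList.length := by
  induction l with
  | nil => simp
  | cons s l ih =>
    rw [List.map_cons, List.prod_cons, mul_smul]
    have := length_of_smul_le s.2 ((l.map fun s => of s.2).prod • w)
    rw [List.length_cons]
    omega

/-- If `g` and `w` commute in the free product, then so do the words `g w` and `w g`; but the
former starts in the factor of `g` and is longer than `w`, while the latter starts in the factor of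
the first letter of `w` unless it is not longer than `w`. -/
theorem eq_empty_of_commute {i : ι} {g : M i} (hg : g ≠ 1) {w : Word M}
    (hw : w.fstIdx ≠ some i) (h : Commute (of g) w.prod) : w = empty := by
  induction w using consRecOn with
  | empty => rfl
  | cons a t w h1 h2 _ =>
    exfalso
    rw [fstIdx_cons] at hw
    have key : of g • cons t w h1 h2 = of t • w.prod • of g • (empty : Word M) := by
      apply equiv.symm.injective
      change prod _ = prod _
      simp only [prod_smul, prod_empty, mul_one]
      rw [h.eq, prod_cons, mul_assoc]
    have hw' : (cons t w h1 h2).fstIdx ≠ some i := by rwa [fstIdx_cons]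
    rw [← cons_eq_smul (h1 := hw') (h2 := hg)] at key
    have hlen : (w.prod • of g • (empty : Word M)).toList.length ≤ w.toList.length + 1 := by
      refine (length_prod_smul_le _ _).trans ?_
      have := length_of_smul_le g (empty : Word M)
      simp only [empty_toList, List.length_nil] at this
      omega
    rcases length_of_smul_le_or_fstIdx_eq t (w.prod • of g • (empty : Word M)) with h' | h'
    · rw [← key] at h'
      simp only [cons_toList, List.length_cons] at h'
      omega
    · rw [← key, fstIdx_cons] at h'
      exact hw h'.symm

end Word

end Word

theorem eq_one_of_commute_of_commute {ι : Type*} {M : ι → Type*} [∀ i, Monoid (M i)]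
    {i j : ι} (hij : i ≠ j) {g : M i} (hg : g ≠ 1) {h : M j} (hh : h ≠ 1) {k : CoprodI M}
    (hgk : Commute (of g) k) (hhk : Commute (of h) k) : k = 1 := by
  classical
  obtain ⟨w, rfl⟩ : ∃ w : Word M, w.prod = k := Word.equiv.symm.surjective k
  by_cases hw : w.fstIdx = some i
  · rw [Word.eq_empty_of_commute hh (by rw [hw]; simpa using hij) hhk, Word.prod_empty]
  · rw [Word.eq_empty_of_commute hg hw hgk, Word.prod_empty]

/-! ### Permuting isomorphic free factors -/

section Permutation

variable {X N : Type*} [Group N]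

/-- The action of the permutations of `X` on the free product of copies of `N` indexed by `X`. -/
def permFactors (X N : Type*) [Group N] :
    Equiv.Perm X →* MulAut (CoprodI fun _ : X => N) where
  toFun σ := MonoidHom.toMulEquiv
    (lift fun x => of (M := fun _ : X => N) (i := σ x))
    (lift fun x => of (M := fun _ : X => N) (i := σ.symm x))
    (by ext x n; simp) (by ext x n; simp)
  map_one' := by
    apply MulEquiv.toMonoidHom_injective
    ext x n
    simp
  map_mul' σ τ := by
    apply MulEquiv.toMonoidHom_injective
    ext x n
    simp

@[simp]
theorem permFactors_of (σ : Equiv.Perm X) (x : X) (n : N) :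
    permFactors X N σ (of (M := fun _ : X => N) (i := x) n) =
      of (M := fun _ : X => N) (i := σ x) n := by
  simp [permFactors]

/-- Distinct free factors contain no conjugate nontrivial elements, since the projection onto one
of them kills the other. -/
theorem eq_of_mul_of_eq_of_mul {x y : X} {n : N} (hn : n ≠ 1) {k : CoprodI fun _ : X => N}
    (h : k * of (M := fun _ : X => N) (i := x) n = of (M := fun _ : X => N) (i := y) n * k) :
    x = y := by
  classical
  by_contra hxy
  have := congrArg (lift fun z : X => if z = y then MonoidHom.id N else 1) h
  simp [hxy, hn] at this

end Permutation

end Monoid.CoprodI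

/-! ### Semicompleteness of central extensions of retracts -/

section Retract

open Subgroup

theorem mem_iaAut_iff {G : Type*} [Group G] {f : MulAut G} :
    f ∈ iaAut G ↔ ∀ g, Abelianization.of (f g) = Abelianization.of g := by
  rw [iaAut, MonoidHom.mem_ker]
  constructor
  · intro h g
    exact DFunLike.congr_fun h (Abelianization.of g)
  · intro h
    ext x
    obtain ⟨g, rfl⟩ := QuotientGroup.mk_surjective x
    exact h g

theorem mem_innAut_iff {G : Type*} [Group G] {f : MulAut G} :
    f ∈ innAut G ↔ ∃ a, ∀ g, f g = a * g * a⁻¹ := by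
  simp only [innAut, MonoidHom.mem_range, MulEquiv.ext_iff, MulAut.conj_apply, eq_comm]

theorem innAut_le_iaAut (G : Type*) [Group G] : innAut G ≤ iaAut G := by
  intro f hf
  obtain ⟨a, ha⟩ := mem_innAut_iff.1 hf
  refine mem_iaAut_iff.2 fun g => ?_
  rw [ha, map_mul, map_mul, map_inv, mul_inv_cancel_comm]

theorem isSemicomplete_iff {G : Type*} [Group G] :
    IsSemicomplete G ↔ ∀ f : MulAut G,
      (∀ g, Abelianization.of (f g) = Abelianization.of g) → ∃ a, ∀ g, f g = a * g * a⁻¹ := by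
  simp only [← mem_iaAut_iff, ← mem_innAut_iff]
  exact ⟨fun h f hf => h ▸ hf, fun h => le_antisymm h (innAut_le_iaAut G)⟩

variable {G H : Type*} [Group G] [Group H] {i : H →* G} {r : G →* H}

theorem mul_inv_mem_ker_of_leftInverse (hri : ∀ h, r (i h) = h) (g : G) :
    g * (i (r g))⁻¹ ∈ r.ker := by
  simp [MonoidHom.mem_ker, hri]

/-- For a retraction `r` with central kernel, `G` is the direct product of `ker r` and a copy
of `H`; this is the projection onto the central factor. -/
def centralProjection (i : H →* G) (r : G →* H) (hri : ∀ h, r (i h) = h)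
    (hr : r.ker ≤ center G) : G →* center G where
  toFun g := ⟨g * (i (r g))⁻¹, hr (mul_inv_mem_ker_of_leftInverse hri g)⟩
  map_one' := by simp
  map_mul' a b := by
    have hb := mem_center_iff.1 (hr (mul_inv_mem_ker_of_leftInverse hri b)) (i (r a))⁻¹
    apply Subtype.ext
    simp only [map_mul, mul_inv_rev, MulMemClass.mk_mul_mk]
    rw [mul_assoc a (i (r a))⁻¹, hb]
    group

theorem coe_centralProjection (hri : ∀ h, r (i h) = h) (hr : r.ker ≤ center G) (g : G) :
    (centralProjection i r hri hr g : G) = g * (i (r g))⁻¹ := rfl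

theorem eq_of_map_eq_of_abelianization_eq (hri : ∀ h, r (i h) = h) (hr : r.ker ≤ center G)
    {x y : G} (hxy : r x = r y) (hab : Abelianization.of x = Abelianization.of y) : x = y := by
  let _ : CommGroup (center G) :=
    { (inferInstance : Group (center G)) with
      mul_comm a b := Subtype.ext (mem_center_iff.1 b.2 a) }
  have h := congrArg (Abelianization.lift (centralProjection i r hri hr)) hab
  rw [Abelianization.lift_apply_of, Abelianization.lift_apply_of, Subtype.ext_iff,
    coe_centralProjection, coe_centralProjection, hxy] at h
  exact mul_right_cancel h

/-- An automorphism of `G` preserves the center, which `r` kills. -/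
theorem map_aut_section_retraction (hri : ∀ h, r (i h) = h) (hr : r.ker ≤ center G)
    (hH : center H = ⊥) (f : MulAut G) (g : G) : r (f (i (r g))) = r (f g) := by
  have hc : f (g * (i (r g))⁻¹) ∈ center G := by
    refine mem_center_iff.2 fun x => ?_
    obtain ⟨x, rfl⟩ := f.surjective x
    rw [← map_mul, ← map_mul,
      mem_center_iff.1 (hr (mul_inv_mem_ker_of_leftInverse hri g)) x]
  have : r (f (g * (i (r g))⁻¹)) ∈ center H := by
    refine mem_center_iff.2 fun x => ?_
    rw [← hri x, ← map_mul, ← map_mul, mem_center_iff.1 hc]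
  rw [hH, mem_bot, map_mul, map_inv, map_mul, map_inv, mul_inv_eq_one] at this
  exact this.symm

/-- An automorphism of `G` descends along a retraction with central kernel onto a centerless
group. -/
def retractAut (hri : ∀ h, r (i h) = h) (hr : r.ker ≤ center G) (hH : center H = ⊥)
    (f : MulAut G) : MulAut H :=
  MonoidHom.toMulEquiv (r.comp (f.toMonoidHom.comp i)) (r.comp (f.symm.toMonoidHom.comp i))
    (by
      ext h
      exact (map_aut_section_retraction hri hr hH f.symm (f (i h))).trans (by simp [hri]))
    (by
      ext h
      exact (map_aut_section_retraction hri hr hH f (f.symm (i h))).trans (by simp [hri]))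

theorem retractAut_apply (hri : ∀ h, r (i h) = h) (hr : r.ker ≤ center G) (hH : center H = ⊥)
    (f : MulAut G) (h : H) : retractAut hri hr hH f h = r (f (i h)) := rfl

/-- The endomorphism of `G` acting as `f` on the retract `H` and trivially on the central
factor. -/
def extendHom (hri : ∀ h, r (i h) = h) (hr : r.ker ≤ center G) (f : H →* H) : G →* G where
  toFun g := centralProjection i r hri hr g * i (f (r g))
  map_one' := by simp
  map_mul' a b := by
    have hb := mem_center_iff.1 (centralProjection i r hri hr b).2 (i (f (r a)))
    simp only [map_mul, Subgroup.coe_mul]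
    rw [mul_assoc, ← mul_assoc _ (i (f (r a))), ← hb]
    group

theorem extendHom_apply (hri : ∀ h, r (i h) = h) (hr : r.ker ≤ center G) (f : H →* H) (g : G) :
    extendHom hri hr f g = g * (i (r g))⁻¹ * i (f (r g)) := rfl

theorem extendHom_extendHom (hri : ∀ h, r (i h) = h) (hr : r.ker ≤ center G) (f f' : H →* H)
    (hf : ∀ h, f (f' h) = h) (g : G) :
    extendHom hri hr f (extendHom hri hr f' g) = g := by
  simp [extendHom_apply, hri, hf]

/-- The automorphism of `G` acting as `f` on the retract `H` and trivially on the central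
factor. -/
def extendAut (hri : ∀ h, r (i h) = h) (hr : r.ker ≤ center G) (f : MulAut H) : MulAut G :=
  MonoidHom.toMulEquiv (extendHom hri hr f.toMonoidHom) (extendHom hri hr f.symm.toMonoidHom)
    (MonoidHom.ext (extendHom_extendHom hri hr _ _ f.symm_apply_apply))
    (MonoidHom.ext (extendHom_extendHom hri hr _ _ f.apply_symm_apply))

theorem extendAut_apply (hri : ∀ h, r (i h) = h) (hr : r.ker ≤ center G) (f : MulAut H) (g : G) :
    extendAut hri hr f g = g * (i (r g))⁻¹ * i (f (r g)) := rfl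

theorem isSemicomplete_iff_of_retract (hri : ∀ h, r (i h) = h) (hr : r.ker ≤ center G)
    (hH : center H = ⊥) : IsSemicomplete G ↔ IsSemicomplete H := by
  rw [isSemicomplete_iff, isSemicomplete_iff]
  constructor
  · intro hG f hf
    obtain ⟨a, ha⟩ := hG (extendAut hri hr f) fun g => by
      rw [extendAut_apply, map_mul, map_mul, ← Abelianization.map_of i (f (r g)), hf,
        Abelianization.map_of, map_inv, inv_mul_cancel_right]
    refine ⟨r a, fun h => ?_⟩
    have := congrArg r (ha (i h))
    simpa [extendAut_apply, hri] using this
  · intro hH' f hf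
    obtain ⟨a, ha⟩ := hH' (retractAut hri hr hH f) fun h => by
      rw [retractAut_apply, ← Abelianization.map_of r, hf, Abelianization.map_of, hri]
    refine ⟨i a, fun g => eq_of_map_eq_of_abelianization_eq hri hr ?_ ?_⟩
    · rw [← map_aut_section_retraction hri hr hH, ← retractAut_apply hri hr hH, ha]
      simp [hri]
    · rw [hf, map_mul, map_mul, map_inv, mul_inv_cancel_comm]

end Retract

/-! ### Homomorphisms out of graph products -/

namespace GraphProduct

open Monoid Subgroup

universe u v

section Lift

variable {V : Type u} {Γ : SimpleGraph V} {G : V → Type v} [∀ a, Group (G a)]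
  {N : Type*} [Group N]

/-- The canonical homomorphism from a vertex group to the graph product. -/
def of (Γ : SimpleGraph V) (a : V) : G a →* GraphProduct Γ G :=
  (QuotientGroup.mk' _).comp CoprodI.of

theorem commute_of {a b : V} (hab : Γ.Adj a b) (g : G a) (h : G b) :
    Commute (of Γ a g) (of Γ b h) := by
  rw [commute_iff_eq, ← mul_inv_eq_one, mul_inv_rev, ← mul_assoc]
  exact (QuotientGroup.eq_one_iff _).2 (subset_normalClosure ⟨a, b, hab, g, h, rfl⟩)

/-- The universal property of the graph product. -/
def lift (f : ∀ a, G a →* N)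
    (hf : ∀ a b, Γ.Adj a b → ∀ g h, Commute (f a g) (f b h)) : GraphProduct Γ G →* N :=
  QuotientGroup.lift _ (CoprodI.lift f) <| normalClosure_le_normal <| by
    rintro _ ⟨a, b, hab, g, h, rfl⟩
    rw [SetLike.mem_coe, MonoidHom.mem_ker]
    simp [(hf a b hab g h).eq]

@[simp]
theorem lift_of (f : ∀ a, G a →* N) (hf : ∀ a b, Γ.Adj a b → ∀ g h, Commute (f a g) (f b h))
    {a : V} (g : G a) : lift f hf (of Γ a g) = f a g :=
  CoprodI.lift_of f g

theorem hom_ext {f f' : GraphProduct Γ G →* N} (h : ∀ a g, f (of Γ a g) = f' (of Γ a g)) :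
    f = f' :=
  QuotientGroup.monoidHom_ext _ <| CoprodI.ext_hom _ _ fun a => MonoidHom.ext (h a)

end Lift

section Center

variable {V : Type u} (Γ : SimpleGraph V) (G : V → Type v) [∀ a, Group (G a)]

open Classical in
/-- The retraction of the graph product that kills the vertex groups with vertex in `s`. -/
noncomputable def kill (s : Set V) : GraphProduct Γ G →* GraphProduct Γ G :=
  lift (fun a => if a ∈ s then 1 else of Γ a) fun a b hab g h => by
    by_cases ha : a ∈ s <;> by_cases hb : b ∈ s <;> simp [ha, hb, commute_of hab]

variable {Γ G}

theorem kill_of_mem {s : Set V} {a : V} (ha : a ∈ s) (g : G a) : kill Γ G s (of Γ a g) = 1 := by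
  simp [kill, ha]

theorem kill_of_notMem {s : Set V} {a : V} (ha : a ∉ s) (g : G a) :
    kill Γ G s (of Γ a g) = of Γ a g := by
  simp [kill, ha]

theorem kill_kill (s t : Set V) (x : GraphProduct Γ G) :
    kill Γ G s (kill Γ G t x) = kill Γ G (s ∪ t) x := by
  refine DFunLike.congr_fun (f := (kill Γ G s).comp (kill Γ G t)) (hom_ext fun a g => ?_) x
  by_cases hs : a ∈ s <;> by_cases ht : a ∈ t <;>
    simp [kill, hs, ht]

theorem kill_univ (x : GraphProduct Γ G) : kill Γ G Set.univ x = 1 :=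
  DFunLike.congr_fun (g := 1)
    (hom_ext (f' := 1) fun a g => kill_of_mem (Set.mem_univ a) g) x

variable (Γ G) in
/-- The subgroup generated by the vertex groups of the neighbours of `c`. -/
def linkSubgroup (c : V) : Subgroup (GraphProduct Γ G) :=
  ⨆ (a : V) (_ : Γ.Adj c a), (of Γ a : G a →* GraphProduct Γ G).range

theorem of_mem_linkSubgroup {c a : V} (h : Γ.Adj c a) (g : G a) :
    of Γ a g ∈ linkSubgroup Γ G c :=
  mem_iSup_of_mem a (mem_iSup_of_mem h ⟨g, rfl⟩)

theorem commute_of_mem_linkSubgroup {c : V} {x : GraphProduct Γ G}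
    (hx : x ∈ linkSubgroup Γ G c) (g : G c) : Commute x (of Γ c g) := by
  have : linkSubgroup Γ G c ≤ centralizer {of Γ c g} := by
    refine iSup₂_le fun a ha => ?_
    rintro _ ⟨h, rfl⟩
    exact mem_centralizer_singleton_iff.2 (commute_of ha g h).symm.eq
  exact mem_centralizer_singleton_iff.1 (this hx)

/-- Killing all vertices but `a` kills the link of `c` and is faithful on the vertex group
at `a`. -/
theorem eq_one_of_of_mem_linkSubgroup {c a : V} (h : ¬ Γ.Adj c a) {g : G a}
    (hg : of Γ a g ∈ linkSubgroup Γ G c) : g = 1 := by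
  classical
  let p : GraphProduct Γ G →* G a :=
    lift (Pi.mulSingle (M := fun b => G b →* G a) a (MonoidHom.id (G a))) fun b b' hb x y => by
      rcases eq_or_ne b a with rfl | hba
      · simp [Pi.mulSingle_eq_of_ne hb.ne']
      · simp [Pi.mulSingle_eq_of_ne hba]
  have hp : linkSubgroup Γ G c ≤ p.ker := by
    refine iSup₂_le fun b hb => ?_
    rintro _ ⟨x, rfl⟩
    have hba : b ≠ a := by rintro rfl; exact h hb
    simp [p, MonoidHom.mem_ker, Pi.mulSingle_eq_of_ne hba]
  simpa [p, MonoidHom.mem_ker] using hp hg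

variable (Γ G) in
/-- The free product of copies of the vertex group at `c`, one for each coset of the subgroup
generated by the link of `c`. The graph product acts on it by permuting the factors. -/
abbrev CosetCoprod (c : V) : Type _ :=
  CoprodI fun _ : GraphProduct Γ G ⧸ linkSubgroup Γ G c => G c

variable (Γ G) in
/-- The action of the graph product on `CosetCoprod Γ G c`. -/
def cosetAction (c : V) : GraphProduct Γ G →* MulAut (CosetCoprod Γ G c) :=
  (CoprodI.permFactors (GraphProduct Γ G ⧸ linkSubgroup Γ G c) (G c)).comp
    (MulAction.toPermHom (GraphProduct Γ G) (GraphProduct Γ G ⧸ linkSubgroup Γ G c))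

variable (Γ G) in
/-- The inclusion of the free factor of the coset of `x`. -/
def factor (c : V) (x : GraphProduct Γ G) : G c →* CosetCoprod Γ G c :=
  CoprodI.of (M := fun _ : GraphProduct Γ G ⧸ linkSubgroup Γ G c => G c)
    (i := (x : GraphProduct Γ G ⧸ linkSubgroup Γ G c))

theorem factor_eq_of_mem {c : V} {x : GraphProduct Γ G} (hx : x ∈ linkSubgroup Γ G c)
    (y : GraphProduct Γ G) : factor Γ G c (y * x) = factor Γ G c y := by
  have : ((y * x : GraphProduct Γ G) : GraphProduct Γ G ⧸ linkSubgroup Γ G c) = y :=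
    (QuotientGroup.eq.2 (by simpa using hx)).symm
  rw [factor, factor, this]

@[simp]
theorem cosetAction_factor (c : V) (x y : GraphProduct Γ G) (g : G c) :
    cosetAction Γ G c x (factor Γ G c y g) = factor Γ G c (x * y) g :=
  CoprodI.permFactors_of _ _ _

open Classical in
variable (Γ G) in
/-- The graph product maps to the semidirect product of `CosetCoprod Γ G c` with itself: the vertex
group at `c` goes to the free factor of the trivial coset, and the other vertex groups go to the
right factor. -/
noncomputable def toSemidirect (c : V) :
    GraphProduct Γ G →* CosetCoprod Γ G c ⋊[cosetAction Γ G c] GraphProduct Γ G :=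
  lift (fun a => if h : a = c then h ▸ (SemidirectProduct.inl.comp (factor Γ G c 1) :
        G c →* CosetCoprod Γ G c ⋊[cosetAction Γ G c] GraphProduct Γ G)
      else SemidirectProduct.inr.comp (of Γ a)) <| by
    have key (a : V) (hac : Γ.Adj c a) (g : G c) (h : G a) :
        Commute (SemidirectProduct.inl (φ := cosetAction Γ G c) (factor Γ G c 1 g))
          (SemidirectProduct.inr (of Γ a h)) := by
      have := SemidirectProduct.inl_aut (φ := cosetAction Γ G c) (of Γ a h) (factor Γ G c 1 g)
      rw [cosetAction_factor, mul_one, ← one_mul (of Γ a h),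
        factor_eq_of_mem (of_mem_linkSubgroup hac h), one_mul, map_inv,
        eq_mul_inv_iff_mul_eq] at this
      exact this
    intro a b hab g h
    by_cases ha : a = c <;> by_cases hb : b = c
    · exact absurd (ha.trans hb.symm) hab.ne
    · subst ha
      simpa [hb] using key b hab g h
    · subst hb
      simpa [ha] using (key a hab.symm h g).symm
    · simpa [ha, hb] using (commute_of hab g h).map SemidirectProduct.inr

theorem toSemidirect_of_self {c : V} (g : G c) :
    toSemidirect Γ G c (of Γ c g) = SemidirectProduct.inl (factor Γ G c 1 g) := by
  simp [toSemidirect]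

theorem toSemidirect_of_ne {c a : V} (h : a ≠ c) (g : G a) :
    toSemidirect Γ G c (of Γ a g) = SemidirectProduct.inr (of Γ a g) := by
  simp [toSemidirect, h]

theorem toSemidirect_right (c : V) (x : GraphProduct Γ G) :
    (toSemidirect Γ G c x).right = kill Γ G {c} x := by
  refine DFunLike.congr_fun (f := SemidirectProduct.rightHom.comp (toSemidirect Γ G c))
    (hom_ext fun a g => ?_) x
  rcases eq_or_ne a c with rfl | h
  · simp [toSemidirect_of_self, kill]
  · simp [toSemidirect_of_ne h, kill, h]

variable (Γ G) in
/-- The evaluation of `CosetCoprod Γ G c` in the graph product, where the factor of a coset `x` is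
the conjugate by `x` of the vertex group at `c`. -/
noncomputable def cosetEval (c : V) : CosetCoprod Γ G c →* GraphProduct Γ G :=
  CoprodI.lift fun x => (MulAut.conj x.out).toMonoidHom.comp (of Γ c)

theorem cosetEval_factor (c : V) (x : GraphProduct Γ G) (g : G c) :
    cosetEval Γ G c (factor Γ G c x g) = x * of Γ c g * x⁻¹ := by
  obtain ⟨m, hm⟩ := QuotientGroup.mk_out_eq_mul (linkSubgroup Γ G c) x
  have := (commute_of_mem_linkSubgroup m.2 g).eq
  simp only [cosetEval, factor, CoprodI.lift_of, MonoidHom.comp_apply,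
    MulEquiv.coe_toMonoidHom, MulAut.conj_apply, hm]
  rw [mul_assoc x, this]
  group

variable (Γ G) in
/-- A left inverse of `toSemidirect`. -/
noncomputable def ofSemidirect (c : V) :
    CosetCoprod Γ G c ⋊[cosetAction Γ G c] GraphProduct Γ G →* GraphProduct Γ G :=
  SemidirectProduct.lift (cosetEval Γ G c) (MonoidHom.id _) fun x => by
    refine CoprodI.ext_hom _ _ fun y => MonoidHom.ext fun g => ?_
    obtain ⟨y, rfl⟩ := QuotientGroup.mk_surjective y
    change cosetEval Γ G c (cosetAction Γ G c x (factor Γ G c y g)) =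
      x * cosetEval Γ G c (factor Γ G c y g) * x⁻¹
    rw [cosetAction_factor, cosetEval_factor, cosetEval_factor]
    group

theorem ofSemidirect_toSemidirect (c : V) (x : GraphProduct Γ G) :
    ofSemidirect Γ G c (toSemidirect Γ G c x) = x := by
  refine DFunLike.congr_fun (f := (ofSemidirect Γ G c).comp (toSemidirect Γ G c))
    (g := MonoidHom.id _) (hom_ext fun a g => ?_) x
  rcases eq_or_ne a c with rfl | h
  · simp [toSemidirect_of_self, ofSemidirect, cosetEval_factor]
  · simp [toSemidirect_of_ne h, ofSemidirect]

/-- A central element has no syllable at a vertex `c` that is not adjacent to some `a ≠ c`: its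
component in `CosetCoprod Γ G c` commutes with the factors of the trivial coset and of the coset of
a nontrivial element of the vertex group at `a`. -/
theorem kill_singleton_of_mem_center [∀ a, Nontrivial (G a)] {c a : V} (hac : a ≠ c)
    (h : ¬ Γ.Adj c a) {z : GraphProduct Γ G} (hz : z ∈ center (GraphProduct Γ G)) :
    kill Γ G {c} z = z := by
  obtain ⟨g, hg⟩ := exists_ne (1 : G c)
  obtain ⟨t, ht⟩ := exists_ne (1 : G a)
  set k := (toSemidirect Γ G c z).left with hk
  set l := kill Γ G {c} z with hl
  have hcomm (x : GraphProduct Γ G) :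
      toSemidirect Γ G c z * toSemidirect Γ G c x =
        toSemidirect Γ G c x * toSemidirect Γ G c z := by
    rw [← map_mul, ← map_mul, mem_center_iff.1 hz]
  have hlt : l * of Γ a t = of Γ a t * l := by
    rw [← kill_of_notMem (s := {c}) hac t, hl, ← map_mul, ← map_mul, mem_center_iff.1 hz]
  have hconj (x : GraphProduct Γ G) (hx : ∃ y, toSemidirect Γ G c y =
      SemidirectProduct.inl (factor Γ G c x g)) :
      k * factor Γ G c (l * x) g = factor Γ G c x g * k := by
    obtain ⟨y, hy⟩ := hx
    have := congrArg SemidirectProduct.left (hcomm y)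
    simpa [hy, toSemidirect_right] using this
  have h1 : k * factor Γ G c l g = factor Γ G c 1 g * k := by
    simpa using hconj 1 ⟨of Γ c g, toSemidirect_of_self g⟩
  have h2 : k * factor Γ G c (l * of Γ a t) g = factor Γ G c (of Γ a t) g * k := by
    refine hconj _ ⟨of Γ a t * of Γ c g * (of Γ a t)⁻¹, ?_⟩
    rw [map_mul, map_mul, map_inv, toSemidirect_of_self, toSemidirect_of_ne hac, ← map_inv,
      ← SemidirectProduct.inl_aut, cosetAction_factor, mul_one]
  have hl1 : (l : GraphProduct Γ G ⧸ linkSubgroup Γ G c) = (1 : GraphProduct Γ G) :=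
    CoprodI.eq_of_mul_of_eq_of_mul hg h1
  have hlmem : l ∈ linkSubgroup Γ G c := by
    simpa using QuotientGroup.eq.1 hl1.symm
  have hk1 : k = 1 := by
    refine CoprodI.eq_one_of_commute_of_commute
      (i := ((1 : GraphProduct Γ G) : GraphProduct Γ G ⧸ linkSubgroup Γ G c))
      (j := (of Γ a t : GraphProduct Γ G ⧸ linkSubgroup Γ G c)) ?_ hg hg
      (k := k) (Eq.symm ?_) (Eq.symm ?_)
    · intro hat
      exact ht (eq_one_of_of_mem_linkSubgroup h (by simpa using QuotientGroup.eq.1 hat))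
    · rw [← one_mul l, factor_eq_of_mem hlmem] at h1
      exact h1
    · rw [hlt, factor_eq_of_mem hlmem] at h2
      exact h2
  have hz' : toSemidirect Γ G c z = SemidirectProduct.inr l :=
    SemidirectProduct.ext hk1 (toSemidirect_right c z)
  rw [← ofSemidirect_toSemidirect c z, hz']
  simp [ofSemidirect]

theorem center_eq_bot [Finite V] [∀ a, Nontrivial (G a)] (hΓ : Γ.coneVertices = ∅) :
    center (GraphProduct Γ G) = ⊥ := by
  rw [eq_bot_iff]
  intro z hz
  have hkill (s : Set V) : kill Γ G s z = z := by
    induction s, s.toFinite using Set.Finite.induction_on with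
    | empty =>
      exact DFunLike.congr_fun (f := kill Γ G ∅) (g := MonoidHom.id _)
        (hom_ext fun a g => kill_of_notMem (Set.notMem_empty a) g) z
    | @insert c s _ _ ih =>
      have hc : Γ.starSet c ≠ Set.univ := fun h => by
        have : c ∈ Γ.coneVertices := h
        simp [hΓ] at this
      obtain ⟨a, ha⟩ := (Set.ne_univ_iff_exists_notMem _).1 hc
      simp only [SimpleGraph.starSet, Set.singleton_union, Set.mem_insert_iff,
        Set.mem_ofPred_eq, not_or] at ha
      rw [Set.insert_eq, ← kill_kill, ih, kill_singleton_of_mem_center ha.1 ha.2 hz]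
  rw [mem_bot, ← hkill Set.univ, kill_univ]

end Center

/-! ### Splitting off the cone vertices -/

section Cone

variable {V : Type u} (Γ : SimpleGraph V) (G : V → Type v) [∀ a, Group (G a)] (s : Set V)

/-- The canonical homomorphism from the graph product over an induced subgraph. -/
def inducedInclusion :
    GraphProduct (Γ.induce s) (fun a : ↥s => G a) →* GraphProduct Γ G :=
  lift (fun a => of Γ (a : V)) fun _ _ hab => commute_of hab

open Classical in
/-- The canonical retraction onto the graph product over an induced subgraph. -/
noncomputable def inducedRetraction :
    GraphProduct Γ G →* GraphProduct (Γ.induce s) (fun a : ↥s => G a) :=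
  lift (fun a => if h : a ∈ s then of (G := fun a : ↥s => G a) (Γ.induce s) ⟨a, h⟩ else 1)
    fun a b hab g h => by
      by_cases ha : a ∈ s <;> by_cases hb : b ∈ s <;> simp only [ha, hb, dite_true, dite_false,
        MonoidHom.one_apply, Commute.one_left, Commute.one_right]
      exact commute_of (G := fun a : ↥s => G a) (Γ := Γ.induce s) (a := ⟨a, ha⟩) (b := ⟨b, hb⟩)
        hab g h

variable {Γ G s}

theorem inducedRetraction_inducedInclusion
    (x : GraphProduct (Γ.induce s) (fun a : ↥s => G a)) :
    inducedRetraction Γ G s (inducedInclusion Γ G s x) = x := by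
  refine DFunLike.congr_fun
    (f := (inducedRetraction Γ G s).comp (inducedInclusion Γ G s))
    (g := MonoidHom.id _) (hom_ext fun a g => ?_) x
  simp [inducedRetraction, inducedInclusion]

theorem of_mem_center {c : V} (hc : c ∈ Γ.coneVertices) (hab : ∀ x y : G c, x * y = y * x)
    (g : G c) : of Γ c g ∈ center (GraphProduct Γ G) := by
  have : MulAut.conj (of Γ c g) = 1 := by
    apply MulEquiv.toMonoidHom_injective
    refine hom_ext fun a h => ?_
    change of Γ c g * of Γ a h * (of Γ c g)⁻¹ = of Γ a h
    rw [mul_inv_eq_iff_eq_mul]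
    have ha : a ∈ Γ.starSet c := by
      rw [show Γ.starSet c = Set.univ from hc]
      trivial
    rcases ha with rfl | ha
    · rw [← map_mul, ← map_mul, hab]
    · exact (commute_of ha g h).eq
  refine mem_center_iff.2 fun x => ?_
  exact (mul_inv_eq_iff_eq_mul.1 (DFunLike.congr_fun this x)).symm

/-- Modulo the center, the retraction that kills the abelian cone vertices is the identity. -/
theorem ker_inducedRetraction_le_center
    (hab : ∀ a ∈ Γ.coneVertices, ∀ x y : G a, x * y = y * x) :
    (inducedRetraction Γ G Γ.coneVerticesᶜ).ker ≤ center (GraphProduct Γ G) := by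
  have key : (QuotientGroup.mk' (center (GraphProduct Γ G))).comp
      ((inducedInclusion Γ G Γ.coneVerticesᶜ).comp (inducedRetraction Γ G Γ.coneVerticesᶜ)) =
      QuotientGroup.mk' (center (GraphProduct Γ G)) := by
    refine hom_ext fun a g => ?_
    by_cases ha : a ∈ Γ.coneVertices
    · have := (QuotientGroup.eq_one_iff (of Γ a g)).2 (of_mem_center ha (hab a ha) g)
      simp [inducedRetraction, ha, this]
    · simp [inducedRetraction, inducedInclusion, ha]
  intro x hx
  have := DFunLike.congr_fun key x
  rw [MonoidHom.comp_apply, MonoidHom.comp_apply, MonoidHom.mem_ker.1 hx, map_one, map_one] at this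
  exact (QuotientGroup.eq_one_iff x).1 this.symm

/-- A vertex that is not a cone vertex misses some vertex, which cannot be a cone vertex either. -/
theorem _root_.SimpleGraph.coneVertices_induce_compl :
    (Γ.induce Γ.coneVerticesᶜ).coneVertices = ∅ := by
  refine Set.eq_empty_iff_forall_notMem.2 fun ⟨a, ha⟩ h => ?_
  obtain ⟨b, hb⟩ := (Set.ne_univ_iff_exists_notMem (Γ.starSet a)).1 ha
  have hbc : b ∉ Γ.coneVertices := fun hbc => by
    have : a ∈ Γ.starSet b := by
      rw [show Γ.starSet b = Set.univ from hbc]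
      trivial
    rcases this with rfl | hba
    · exact hb (Or.inl rfl)
    · exact hb (Or.inr hba.symm)
  have : (⟨b, hbc⟩ : ↥Γ.coneVerticesᶜ) ∈ (Γ.induce Γ.coneVerticesᶜ).starSet ⟨a, ha⟩ := by
    rw [show (Γ.induce Γ.coneVerticesᶜ).starSet ⟨a, ha⟩ = Set.univ from h]
    trivial
  rcases this with hba | hba
  · exact hb (Or.inl (congrArg Subtype.val hba))
  · exact hb (Or.inr hba)

end Cone

end GraphProduct

theorem propositionB {V : Type*} [Finite V] (Γ : SimpleGraph V) (G : V → Type*)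
    [∀ a, Group (G a)] [∀ a, Nontrivial (G a)]
    (hab : ∀ a ∈ Γ.coneVertices, ∀ x y : G a, x * y = y * x) :
    IsSemicomplete (GraphProduct Γ G) ↔
      IsSemicomplete (GraphProduct (Γ.induce (Γ.coneVerticesᶜ))
        (fun a : ↥(Γ.coneVerticesᶜ) => G a)) :=
  isSemicomplete_iff_of_retract GraphProduct.inducedRetraction_inducedInclusion
    (GraphProduct.ker_inducedRetraction_le_center hab)
    (GraphProduct.center_eq_bot SimpleGraph.coneVertices_induce_compl)
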